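/- Let $b$ be a prime, $\omega_b=e^{2\pi \mathrm{i}/b}$, and let $d,s,m\ge 1$, $t\ge 0$ be integers. Base $b$ digits of $x\in[0,1)$, $x=\xi_1b^{-1}+\xi_2b^{-2}+\cdots$, are always those with infinitely many $\xi_a\ne b-1$. A family of points $z_0,\dots,z_{b^m-1}\in[0,1)^{ds}$ is a digital $(t,m,ds)$-net over $\mathbb{Z}_b$ if (a) there are matrices $C_1,\dots,C_{ds}$ over $\mathbb{Z}_b$ with $m$ columns and $R$ rows (for some $R$) such that, for $n=n_0+n_1b+\cdots+n_{m-1}b^{m-1}$ and $(y_{n,i,1},\dots,y_{n,i,R})^\top=C_i(n_0,\dots,n_{m-1})^\top$ (entries identified with $\{0,\dots,b-1\}$), $z_{n,i}=\sum_{j=1}^{R}y_{n,i,j}b^{-j}$; and (b) for all integers $e_1,\dots,e_{ds}\ge 0$ with $e_1+\cdots+e_{ds}\le m-t$ and all $0\le a_i<b^{e_i}$, the interval $\prod_{i=1}^{ds}[a_ib^{-e_i},(a_i+1)b^{-e_i})$ contains exactly $b^{m-e_1-\cdots-e_{ds}}$ of the points (counted with multiplicity). The digit interlacing function $\mathscr{D}_d:[0,1)^d\to[0,1)$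 is $\mathscr{D}_d(x_1,\dots,x_d)=\sum_{a\ge1}\sum_{r=1}^d\xi_{r,a}b^{-r-(a-1)d}$, where $x_r=\sum_{a\ge 1}\xi_{r,a}b^{-a}$; it is injective, and $\mathscr{D}_d:[0,1)^{ds}\to[0,1)^s$ is obtained by applying it to the $s$ consecutive blocks of $d$ coordinates. For $k=\sum_{j\ge0}\kappa_jb^j\in\mathbb{N}_0$ the Walsh function is $\mathrm{wal}_k(x)=\omega_b^{\xi_1\kappa_0+\xi_2\kappa_1+\cdots}$, and $\mathrm{wal}_{(k_1,\dots,k_d)}(x_1,\dots,x_d)=\prod_{r=1}^d\mathrm{wal}_{k_r}(x_r)$. Owen's scrambling $x_\Pi$ of $x\in[0,1)^d$ replaces, for each $i$ and $a$, the $a$-th digit $\xi_{i,a}$ of $x_i$ by $\pi_{i,\xi_{i,1},\dots,\xi_{i,a-1}}(\xi_{i,a})$, where the permutations $\pi_{i,c_1,\dots,c_{a-1}}$ of $\{0,\dots,b-1\}$ ($1\le i\le d$, $a\ge1$, $c_j\in\{0,\dots,b-1\}$) are independent and uniformly distributed. For $\ell\in\mathbb{N}_0^{ds}$ let $|\ell|_1=\ell_1+\cdots+\ell_{ds}$,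 let $q=\{i\in\{1,\dots,ds\}:\ell_i\ne0\}$, and let $B_{d,\ell,s}$ be the set of all $k\in\mathbb{N}_0^{ds}$ with $\lfloor b^{\ell_i-1}\rfloor\le k_i<b^{\ell_i}$ for $1\le i\le ds$. The gain coefficient of order $d$ of points $P=\{x_0,\dots,x_{b^m-1}\}$ in the image $\mathscr{D}_d([0,1)^{ds})\subseteq[0,1)^s$ is, for an arbitrary choice of $k\in B_{d,\ell,s}$, $$\Gamma_{d,\ell}(P)=\frac1{b^{2m}}\sum_{n,n'=0}^{b^m-1}\prod_{i=1}^s\mathbb{E}\left[\mathrm{wal}_{(k_{d(i-1)+1},\dots,k_{di})}\big(\mathscr{D}_d^{-1}(x_{n,i})_{\Pi}\big)\,\overline{\mathrm{wal}_{(k_{d(i-1)+1},\dots,k_{di})}\big(\mathscr{D}_d^{-1}(x_{n',i})_{\Pi}\big)}\right].$$ **Lemma.** Let $z_0,\dots,z_{b^m-1}$ be a digital $(t,m,ds)$-net over $\mathbb{Z}_b$ and let $P_{b^m}=\{x_0,\dots,x_{b^m-1}\}$ with $x_n=\mathscr{D}_d(z_n)$. Then for every $\ell\in\mathbb{N}_0^{ds}\setminus\{0\}$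 (and for every choice of $k\in B_{d,\ell,s}$) the number $\Gamma_{d,\ell}(P_{b^m})$ is real and - $\Gamma_{d,\ell}(P_{b^m})=0$ if $|\ell|_1\le m-t$; - $\Gamma_{d,\ell}(P_{b^m})\le b^{|q|-|\ell|_1}$ if $m-t<|\ell|_1\le m-t+|q|$; - $\Gamma_{d,\ell}(P_{b^m})\le b^{-m+t}$ if $|\ell|_1>m-t+|q|$. -/

import Mathlib

open MeasureTheory

noncomputable section

namespace OwenScrambling

/-! Points live in `[0,1)^ι` and are represented as functions `ι → ℝ`. The base `b` digits of a
real number are Mathlib's `Real.digits x b`, with `Real.digits x b a` the digit of `b ^ (-(a + 1))`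
(defined by floors, so that `b`-adic rationals get their finite expansion). A family of `d * s`
coordinates is indexed by `Fin s × Fin d`: the pair `(i, r)` is coordinate `i * d + r`, the `r`-th
coordinate of the `i`-th block of length `d` (everything counted from `0`). -/

/-! ### Digital nets -/

/-- The vector of the `m` base `b` digits of `n`, least significant first, over `ZMod b`. -/
def digitVec (b m n : ℕ) : Fin m → ZMod b := fun j => ((n / b ^ (j : ℕ) % b : ℕ) : ZMod b)

/-- The points of the digital construction scheme with generating matrices `C i`
(of size `R × m`): the `i`-th coordinate of the `n`-th point is
`∑ j, y j * b ^ (-(j + 1))`, where `y = C i *ᵥ (digits of n)`. -/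
def digitalPoint {b m R : ℕ} {ι : Type} (C : ι → Matrix (Fin R) (Fin m) (ZMod b)) (n : ℕ) :
    ι → ℝ :=
  fun i => ∑ j : Fin R,
    ((Matrix.mulVec (C i) (digitVec b m n) j).val : ℝ) / (b : ℝ) ^ ((j : ℕ) + 1)

/-- `(t, m, |ι|)`-nets in base `b`: every elementary interval `∏ i, [a i / b ^ e i, (a i + 1) /
b ^ e i)` with `∑ i, e i ≤ m - t` contains the expected number `b ^ (m - ∑ i, e i)` of points
(counted with multiplicity). -/
def IsNet (b t m : ℕ) {ι : Type} [Fintype ι] (z : Fin (b ^ m) → ι → ℝ) : Prop :=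
  (∀ n i, z n i ∈ Set.Ico (0 : ℝ) 1) ∧
    ∀ e : ι → ℕ, (∑ i, e i) + t ≤ m → ∀ a : ι → ℕ, (∀ i, a i < b ^ e i) →
      Nat.card {n : Fin (b ^ m) //
        ∀ i, z n i ∈ Set.Ico ((a i : ℝ) / (b : ℝ) ^ e i) (((a i : ℝ) + 1) / (b : ℝ) ^ e i)}
        = b ^ (m - ∑ i, e i)

/-- Digital `(t, m, |ι|)`-nets over `ZMod b`: `(t, m, |ι|)`-nets that are given by the digital
construction scheme, with matrices with `m` columns and any number `R` of rows. -/
def IsDigitalNet (b t m : ℕ) {ι : Type} [Fintype ι] (z : Fin (b ^ m) → ι → ℝ) : Prop :=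
  (∃ (R : ℕ) (C : ι → Matrix (Fin R) (Fin m) (ZMod b)),
    ∀ n : Fin (b ^ m), z n = digitalPoint C n) ∧ IsNet b t m z

/-! ### Digit interlacing -/

/-- The digit interlacing function `[0,1)^d → [0,1)`:
the `a`-th digit of `x r` becomes the digit number `a * d + r` (counted from `0`). -/
def interlace (b d : ℕ) [NeZero b] (x : Fin d → ℝ) : ℝ :=
  ∑' a : ℕ, ∑ r : Fin d,
    ((Real.digits (x r) b a : ℕ) : ℝ) / (b : ℝ) ^ ((r : ℕ) + 1 + a * d)

/-- The inverse of the digit interlacing function on `[0,1)^d`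
(only meaningful on the image of `[0,1)^d`). -/
def interlaceInv (b d : ℕ) [NeZero b] : ℝ → Fin d → ℝ :=
  Function.invFunOn (interlace b d) (Set.univ.pi fun _ => Set.Ico (0 : ℝ) 1)

/-! ### Walsh functions -/

/-- The `k`-th Walsh function in base `b`: `ω ^ (∑ j, κ j * ξ j)` with `ω = exp (2 π i / b)`,
where `κ j` are the base `b` digits of `k` and `ξ j` those of `x`. -/
def walsh (b : ℕ) [NeZero b] (k : ℕ) (x : ℝ) : ℂ :=
  Complex.exp (2 * Real.pi * Complex.I / b) ^
    (∑ j ∈ Finset.range (Nat.digits b k).length, (k / b ^ j % b) * (Real.digits x b j : ℕ))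

/-- Multivariate Walsh functions. -/
def walshMulti (b : ℕ) [NeZero b] {ι : Type} [Fintype ι] (k : ι → ℕ) (x : ι → ℝ) : ℂ :=
  ∏ i, walsh b (k i) (x i)

/-! ### Owen's scrambling -/

instance instMeasurableSpacePerm (b : ℕ) : MeasurableSpace (Equiv.Perm (Fin b)) := ⊤

/-- A set of permutations for scrambling points of `[0,1)^ι`:
one permutation for each coordinate `i` and each finite string of previous digits. -/
abbrev PermFamily (b : ℕ) (ι : Type) : Type := ι × List (Fin b) → Equiv.Perm (Fin b)

/-- Owen's scrambling of a point `x` by a set of permutations: the `a`-th digit of `x i` is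
replaced by its image under the permutation with index `i` and the preceding digits of `x i`. -/
def scramble {b : ℕ} [NeZero b] {ι : Type} (P : PermFamily b ι) (x : ι → ℝ) : ι → ℝ :=
  fun i => Real.ofDigits fun a : ℕ =>
    P (i, List.ofFn fun j : Fin a => Real.digits (x i) b j) (Real.digits (x i) b a)

/-- The law of a uniformly and i.i.d. chosen set of permutations. -/
def scrambleLaw (b : ℕ) (ι : Type) : Measure (PermFamily b ι) :=
  Measure.infinitePi fun _ : ι × List (Fin b) =>
    (PMF.uniformOfFintype (Equiv.Perm (Fin b))).toMeasure

/-! ### Gain coefficients -/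

/-- The set of all `k` with `⌊b ^ (l i - 1)⌋ ≤ k i < b ^ l i` for all `i`
(here `b ^ l i / b` is a quotient of natural numbers, rounded down). -/
def walshBlock (b : ℕ) {ι : Type} (l : ι → ℕ) : Set (ι → ℕ) :=
  {k | ∀ i, b ^ l i / b ≤ k i ∧ k i < b ^ l i}

/-- The gain coefficient of order `d` of the points `x 0, …, x (b ^ m - 1)` in `[0,1)^s`, computed
with the representative `k` of a block `walshBlock b l`. -/
def gainCoeff (b d : ℕ) [NeZero b] {m s : ℕ} (x : Fin (b ^ m) → Fin s → ℝ)
    (k : Fin s × Fin d → ℕ) : ℂ :=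
  1 / (b : ℂ) ^ (2 * m) * ∑ n : Fin (b ^ m), ∑ n' : Fin (b ^ m), ∏ i : Fin s,
    ∫ P : PermFamily b (Fin d),
      walshMulti b (fun r => k (i, r)) (scramble P (interlaceInv b d (x n i))) *
        starRingEnd ℂ
          (walshMulti b (fun r => k (i, r)) (scramble P (interlaceInv b d (x n' i))))
      ∂(scrambleLaw b (Fin d))

end OwenScrambling

end

/-! The expectation of a Walsh function at one scrambled point times its conjugate at another
factors over the coordinates and, in each coordinate, over the permutations met along the two
expansions. Before the expansions split, both see the same permutation and the same digit, and the
two factors cancel. At the split they see two distinct values of one random permutation, and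
afterwards independent permutations; since a nontrivial character of the digits sums to `0`, the
expectation in a coordinate with `l` Walsh digits is `1` if the first `l` digits agree,
`-1 / (b - 1)` if only the first `l - 1` agree, and `0` otherwise. The gain coefficient is the
average over all pairs of points of the product of these kernels.

The kernel is a linear combination of the indicators of agreement in the first `l` digits and in the
first `l - 1` digits, and a net averages products of such indicators exactly as the uniform
distribution does, for which the average kernel is `0` when `l ≠ 0`. When there are more Walsh
digits than the net can resolve, the kernel is still bounded in absolute value by the indicator of
agreement in the first `e` digits for every `e ≤ l - 1`; the exponents `e` are chosen as large as
the net allows. -/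

namespace OwenScrambling

section DigitExpansions

variable {b : ℕ}

/-- The digit expansions that occur as `Real.digits` of a number in `[0,1)`: infinitely many digits
differ from `b - 1`. -/
def IsProperExpansion (D : ℕ → Fin b) : Prop :=
  ∃ᶠ a in Filter.atTop, (D a : ℕ) + 1 < b

theorem IsProperExpansion.tail {D : ℕ → Fin b} (hD : IsProperExpansion D) :
    IsProperExpansion fun i => D (i + 1) := by
  rw [IsProperExpansion, ← Filter.map_add_atTop_eq_nat 1] at hD
  exact hD

theorem IsProperExpansion.ofDigits_lt_one {D : ℕ → Fin b} (hD : IsProperExpansion D) :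
    Real.ofDigits D < 1 := by
  obtain ⟨a, ha⟩ := hD.exists
  have hb : 1 < b := by lia
  rw [← Real.ofDigits_const_last_eq_one' hb]
  refine Summable.tsum_lt_tsum (i := a) (fun i => ?_) ?_ Real.summable_ofDigitsTerm
    Real.summable_ofDigitsTerm
  · have : (D i : ℕ) ≤ b - 1 := Nat.le_sub_one_of_lt (D i).isLt
    simp only [Real.ofDigitsTerm]
    gcongr
  · have : (D a : ℕ) < b - 1 := by lia
    simp only [Real.ofDigitsTerm]
    gcongr

theorem natCast_mul_ofDigits (D : ℕ → Fin b) :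
    (b : ℝ) * Real.ofDigits D = D 0 + Real.ofDigits fun i => D (i + 1) := by
  have hb : (b : ℝ) ≠ 0 := by exact_mod_cast (Fin.pos (D 0)).ne'
  rw [Real.ofDigits_eq_sum_add_ofDigits D 1, Finset.sum_range_one, Real.ofDigitsTerm]
  field_simp
  ring

variable [NeZero b]

theorem digits_ofDigits {D : ℕ → Fin b} (hD : IsProperExpansion D) :
    Real.digits (Real.ofDigits D) b = D := by
  funext n
  induction n generalizing D with
  | zero =>
    have hfloor : ⌊Real.ofDigits (fun i => D (i + 1))⌋₊ = 0 :=
      Nat.floor_eq_zero.2 hD.tail.ofDigits_lt_one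
    simp only [Real.digits, zero_add, pow_one]
    rw [mul_comm, natCast_mul_ofDigits, add_comm, Nat.floor_add_natCast (Real.ofDigits_nonneg _),
      hfloor, zero_add, Fin.ofNat_val_eq_self]
  | succ n ih =>
    rw [← ih hD.tail]
    ext
    have hshift : Real.ofDigits D * (b : ℝ) ^ (n + 1 + 1) =
        Real.ofDigits (fun i => D (i + 1)) * (b : ℝ) ^ (n + 1) +
          ((b * (D 0 * b ^ n) : ℕ) : ℝ) := by
      push_cast
      linear_combination (b : ℝ) ^ (n + 1) * natCast_mul_ofDigits D
    rw [Real.digits, Real.digits, Fin.val_ofNat, Fin.val_ofNat, hshift, Nat.floor_add_natCast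
      (mul_nonneg (Real.ofDigits_nonneg _) (by positivity)), Nat.add_mul_mod_self_left]

theorem isProperExpansion_digits (hb : 1 < b) {x : ℝ} (hx : x ∈ Set.Ico (0 : ℝ) 1) :
    IsProperExpansion (Real.digits x b) := by
  rw [IsProperExpansion, Filter.frequently_atTop]
  intro N
  by_contra! hmax
  have htail : (fun i => Real.digits x b (i + N)) = fun _ => ⟨b - 1, Nat.sub_one_lt_of_lt hb⟩ := by
    funext i
    ext
    have := hmax (i + N) (by lia)
    have := (Real.digits x b (i + N)).isLt
    simp only
    lia
  have hexpand := Real.ofDigits_eq_sum_add_ofDigits (Real.digits x b) N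
  rw [htail, Real.ofDigits_const_last_eq_one' hb, Real.ofDigits_digits hb hx, mul_one] at hexpand
  have hscaled : (b : ℝ) ^ N * x = ⌊(b : ℝ) ^ N * x⌋₊ + 1 := by
    rw [← Real.ofDigits_digits_sum_eq hx N]
    conv_lhs => rw [hexpand]
    have : (b : ℝ) ≠ 0 := NeZero.ne _
    field_simp
  exact (Nat.lt_floor_add_one _).ne hscaled

theorem digits_injOn (hb : 1 < b) : Set.InjOn (Real.digits · b) (Set.Ico (0 : ℝ) 1) :=
  Set.LeftInvOn.injOn (f₁' := Real.ofDigits) fun _ => Real.ofDigits_digits hb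

theorem val_digits_eq_floor_div_mod (x : ℝ) {j n : ℕ} (hj : j < n) :
    (Real.digits x b j : ℕ) = ⌊(b : ℝ) ^ n * x⌋₊ / b ^ (n - (j + 1)) % b := by
  have hsplit : (b : ℝ) ^ n * x = (b ^ (n - (j + 1)) : ℕ) * (x * (b : ℝ) ^ (j + 1)) := by
    rw [← Nat.sub_add_cancel hj, pow_add, Nat.succ_eq_add_one, Nat.add_sub_cancel]
    push_cast
    ring
  rw [hsplit, Nat.cast_mul_floor_div_cancel (pow_ne_zero _ (NeZero.ne b)), Real.digits,
    Fin.val_ofNat]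

theorem forall_digits_eq_iff_floor_eq {x y : ℝ} (hx : x ∈ Set.Ico (0 : ℝ) 1)
    (hy : y ∈ Set.Ico (0 : ℝ) 1) (n : ℕ) :
    (∀ j < n, Real.digits x b j = Real.digits y b j) ↔
      ⌊(b : ℝ) ^ n * x⌋₊ = ⌊(b : ℝ) ^ n * y⌋₊ := by
  refine ⟨fun h => ?_, fun h j hj => ?_⟩
  · rw [← Nat.cast_inj (R := ℝ), ← Real.ofDigits_digits_sum_eq hx n,
      ← Real.ofDigits_digits_sum_eq hy n]
    congr 1
    refine Finset.sum_congr rfl fun j hj => ?_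
    rw [Real.ofDigitsTerm, Real.ofDigitsTerm, h j (Finset.mem_range.1 hj)]
  · ext
    rw [val_digits_eq_floor_div_mod x hj, val_digits_eq_floor_div_mod y hj, h]

end DigitExpansions

section Interlacing

variable {b d : ℕ} [NeZero b]

theorem interlace_eq_ofDigits [NeZero d] (x : Fin d → ℝ) :
    interlace b d x = Real.ofDigits fun n => Real.digits (x (Fin.ofNat d n)) b (n / d) := by
  set D : ℕ → Fin b := fun n => Real.digits (x (Fin.ofNat d n)) b (n / d) with hD
  have hsummable : Summable fun p => Real.ofDigitsTerm D ((Nat.divModEquiv d).symm p) :=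
    (Nat.divModEquiv d).symm.summable_iff.2 Real.summable_ofDigitsTerm
  rw [Real.ofDigits, ← (Nat.divModEquiv d).symm.tsum_eq, hsummable.tsum_prod' fun a => .of_finite,
    interlace]
  refine tsum_congr fun a => ?_
  rw [tsum_fintype]
  refine Finset.sum_congr rfl fun r _ => ?_
  have hinv := (Nat.divModEquiv d).apply_symm_apply (a, r)
  simp only [Nat.divModEquiv, Equiv.coe_fn_mk, Equiv.coe_fn_symm_mk, Prod.mk.injEq] at hinv ⊢
  rw [Real.ofDigitsTerm, hD]
  simp only [hinv, div_eq_mul_inv]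
  congr 3
  ring

theorem digits_interlace [NeZero d] (hb : 1 < b) {x : Fin d → ℝ}
    (hx : ∀ r, x r ∈ Set.Ico (0 : ℝ) 1) :
    Real.digits (interlace b d x) b =
      fun n => Real.digits (x (Fin.ofNat d n)) b (n / d) := by
  rw [interlace_eq_ofDigits]
  refine digits_ofDigits (Filter.frequently_atTop.2 fun N => ?_)
  obtain ⟨a, haN, ha⟩ := Filter.frequently_atTop.1 (isProperExpansion_digits hb (hx 0)) N
  refine ⟨d * a, haN.trans (Nat.le_mul_of_pos_left a (NeZero.pos d)), ?_⟩
  have hzero : Fin.ofNat d (d * a) = 0 := by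
    ext
    simp
  simpa only [hzero, Nat.mul_div_cancel_left a (NeZero.pos d)] using ha

theorem interlace_injOn (hb : 1 < b) :
    Set.InjOn (interlace b d) (Set.univ.pi fun _ => Set.Ico (0 : ℝ) 1) := by
  intro x hx y hy hxy
  rw [Set.mem_univ_pi] at hx hy
  funext r
  have : NeZero d := ⟨r.pos.ne'⟩
  refine digits_injOn hb (hx r) (hy r) (funext fun a => ?_)
  have hdigit := congrFun ((digits_interlace hb hx).symm.trans
    ((congrArg (Real.digits · b) hxy).trans (digits_interlace hb hy)))
    ((Nat.divModEquiv d).symm (a, r))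
  obtain ⟨hdiv, hmod⟩ := Prod.mk.inj ((Nat.divModEquiv d).apply_symm_apply (a, r))
  rwa [hdiv, hmod] at hdigit

theorem interlaceInv_interlace (hb : 1 < b) {x : Fin d → ℝ}
    (hx : ∀ r, x r ∈ Set.Ico (0 : ℝ) 1) : interlaceInv b d (interlace b d x) = x :=
  (interlace_injOn hb).leftInvOn_invFunOn fun r _ => hx r

end Interlacing

section InitialWords

variable {α : Type*}

/-- The string of the first `n` terms of a sequence; the strings of this form index the permutations
that a scrambling applies along a digit expansion. -/
def initialWord (u : ℕ → α) (n : ℕ) : List α :=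
  List.ofFn fun j : Fin n => u j

theorem length_initialWord (u : ℕ → α) (n : ℕ) : (initialWord u n).length = n :=
  List.length_ofFn

theorem initialWord_injective (u : ℕ → α) : Function.Injective (initialWord u) :=
  Function.LeftInverse.injective (length_initialWord u)

theorem initialWord_eq_iff {u v : ℕ → α} {n : ℕ} :
    initialWord u n = initialWord v n ↔ ∀ j < n, u j = v j := by
  rw [initialWord, initialWord, List.ofFn_inj, funext_iff, Fin.forall_iff]

theorem initialWord_eq_of_le {u v : ℕ → α} {m n : ℕ} (hmn : m ≤ n)
    (h : initialWord u n = initialWord v n) : initialWord u m = initialWord v m :=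
  initialWord_eq_iff.2 fun j hj => initialWord_eq_iff.1 h j (hj.trans_le hmn)

variable [DecidableEq α]

/-- The strings of the first `0, …, l - 1` terms of a sequence. -/
def initialWords (u : ℕ → α) (l : ℕ) : Finset (List α) :=
  (Finset.range l).image (initialWord u)

theorem mem_initialWords {u : ℕ → α} {l : ℕ} {w : List α} :
    w ∈ initialWords u l ↔ w.length < l ∧ initialWord u w.length = w := by
  simp only [initialWords, Finset.mem_image, Finset.mem_range]
  refine ⟨?_, fun h => ⟨_, h⟩⟩
  rintro ⟨j, hj, rfl⟩
  rw [length_initialWord]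
  exact ⟨hj, rfl⟩

theorem initialWord_mem_initialWords {u : ℕ → α} {j l : ℕ} (hj : j < l) :
    initialWord u j ∈ initialWords u l :=
  Finset.mem_image_of_mem _ (Finset.mem_range.2 hj)

theorem prod_ite_mem_initialWords {M : Type*} [CommMonoid M] {u : ℕ → α} {l : ℕ}
    {T : Finset (List α)} (hT : initialWords u l ⊆ T) (f : List α → M) :
    ∏ w ∈ T, (if w ∈ initialWords u l then f w else 1) =
      ∏ j ∈ Finset.range l, f (initialWord u j) := by
  rw [Finset.prod_ite_mem, Finset.inter_eq_right.2 hT, initialWords,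
    Finset.prod_image (initialWord_injective u).injOn]

/-- The indicator function of the pairs of sequences that share their first `n` terms. -/
noncomputable def agreement (n : ℕ) (u v : ℕ → α) : ℝ :=
  if initialWord u n = initialWord v n then 1 else 0

end InitialWords

section GainKernel

variable {b : ℕ}

/-- The expectation of `wal_k` at one scrambled point times its conjugate at another, as a function
of the digits of the two points before scrambling; it depends on `k` only through the number `l` of
its digits. -/
noncomputable def gainKernel (l : ℕ) (u v : ℕ → Fin b) : ℝ :=
  if initialWord u l = initialWord v l then 1
  else if initialWord u (l - 1) = initialWord v (l - 1) then -1 / ((b : ℝ) - 1) else 0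

theorem gainKernel_eq_sum_agreement (hb : 1 < b) (l : ℕ) (u v : ℕ → Fin b) :
    gainKernel l u v =
      ∑ c : Fin 2, ![(b : ℝ) / (b - 1), -1 / (b - 1)] c * agreement (![l, l - 1] c) u v := by
  have hb1 : (b : ℝ) - 1 ≠ 0 := sub_ne_zero.2 (by exact_mod_cast hb.ne')
  rw [Fin.sum_univ_two]
  change _ = b / (b - 1) * agreement l u v + -1 / (b - 1) * agreement (l - 1) u v
  rw [gainKernel, agreement, agreement]
  split_ifs with hagree hagree' hagree'
  · field_simp
    ring
  · exact absurd (initialWord_eq_of_le (Nat.sub_le l 1) hagree) hagree'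
  · ring
  · ring

theorem abs_gainKernel_le_agreement (hb : 1 < b) {e l : ℕ} (hel : e ≤ l - 1) (u v : ℕ → Fin b) :
    |gainKernel l u v| ≤ agreement e u v := by
  have hnonneg : 0 ≤ agreement e u v := by
    rw [agreement]
    positivity
  have hone : initialWord u (l - 1) = initialWord v (l - 1) → agreement e u v = 1 := fun h =>
    if_pos (initialWord_eq_of_le hel h)
  have hb1 : (1 : ℝ) ≤ b - 1 := by
    rw [le_sub_iff_add_le]
    exact_mod_cast hb
  rw [gainKernel]
  split_ifs with hagree hagree'
  · rw [hone (initialWord_eq_of_le (Nat.sub_le l 1) hagree), abs_one]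
  · rw [hone hagree', abs_div, abs_neg, abs_one, abs_of_nonneg (by linarith)]
    exact div_le_one_of_le₀ hb1 (by linarith)
  · rwa [abs_zero]

end GainKernel

section PermutationAverages

open scoped BigOperators

variable {α : Type*} [Fintype α] [DecidableEq α]

theorem expect_perm_apply {M : Type*} [AddCommMonoid M] [Module ℚ≥0 M] (f : α → M) (a : α) :
    𝔼 π : Equiv.Perm α, f (π a) = 𝔼 v, f v := by
  have : Nonempty α := ⟨a⟩
  have hconst : ∀ c, 𝔼 π : Equiv.Perm α, f (π c) = 𝔼 π : Equiv.Perm α, f (π a) := fun c =>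
    Fintype.expect_equiv (Equiv.mulRight (Equiv.swap a c)) _ _ fun π => by simp
  calc 𝔼 π : Equiv.Perm α, f (π a) = 𝔼 c, 𝔼 π : Equiv.Perm α, f (π c) := by
        simp only [hconst, Fintype.expect_const]
    _ = 𝔼 π : Equiv.Perm α, 𝔼 c, f (π c) := Finset.expect_comm ..
    _ = 𝔼 _π : Equiv.Perm α, 𝔼 v, f v :=
        Finset.expect_congr rfl fun π _ => Fintype.expect_equiv π _ f fun _ => rfl
    _ = 𝔼 v, f v := Fintype.expect_const _

theorem expect_perm_apply_mul_apply {K : Type*} [Field K] [CharZero K] {g : α → K}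
    (hg : ∑ v, g v = 0) (f : α → K) {a c : α} (hac : a ≠ c) :
    ((Fintype.card α : K) - 1) * 𝔼 π : Equiv.Perm α, f (π a) * g (π c) = -𝔼 v, f v * g v := by
  have hconst : ∀ e ∈ Finset.univ.erase a, 𝔼 π : Equiv.Perm α, f (π a) * g (π e) =
      𝔼 π : Equiv.Perm α, f (π a) * g (π c) := fun e he =>
    Fintype.expect_equiv (Equiv.mulRight (Equiv.swap c e)) _ _ fun π => by
      simp [Equiv.swap_apply_of_ne_of_ne hac (Finset.ne_of_mem_erase he).symm]
  have hsum : ∑ e, 𝔼 π : Equiv.Perm α, f (π a) * g (π e) = 0 := by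
    rw [← Finset.expect_sum_comm]
    refine Finset.expect_eq_zero fun π _ => ?_
    rw [← Finset.mul_sum, Equiv.sum_comp π g, hg, mul_zero]
  rw [← Finset.add_sum_erase _ _ (Finset.mem_univ a), Finset.sum_congr rfl hconst,
    expect_perm_apply (fun v => f v * g v), Finset.sum_const,
    Finset.card_erase_of_mem (Finset.mem_univ a), Finset.card_univ, nsmul_eq_mul,
    Nat.cast_pred (Fintype.card_pos_iff.2 ⟨a⟩)] at hsum
  linear_combination hsum

end PermutationAverages

section DigitCharacters

variable {b κ : ℕ}

/-- The character `v ↦ exp (2 π i κ v / b)` of the digits: the contribution of one digit `v` to a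
Walsh function, where `κ` is the corresponding digit of its index. -/
noncomputable def digitChar (b κ : ℕ) (v : Fin b) : ℂ :=
  Complex.exp (2 * Real.pi * Complex.I / b) ^ (κ * (v : ℕ))

theorem norm_digitChar (v : Fin b) : ‖digitChar b κ v‖ = 1 := by
  have hb : b ≠ 0 := v.pos.ne'
  rw [digitChar, norm_pow, (Complex.isPrimitiveRoot_exp b hb).norm'_eq_one hb, one_pow]

theorem sum_digitChar (hκ : κ ≠ 0) (hκb : κ < b) : ∑ v, digitChar b κ v = 0 := by
  have hprim := Complex.isPrimitiveRoot_exp b (by lia)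
  simp only [digitChar, pow_mul]
  rw [Fin.sum_univ_eq_sum_range fun v => (_ ^ κ) ^ v,
    geom_sum_eq (hprim.pow_ne_one_of_pos_of_lt hκ hκb), pow_right_comm, hprim.pow_eq_one, one_pow,
    sub_self, zero_div]

theorem walsh_eq_prod [NeZero b] (hb : 1 < b) {k L : ℕ} (hk : k < b ^ L) (x : ℝ) :
    walsh b k x = ∏ j ∈ Finset.range L, digitChar b (k / b ^ j % b) (Real.digits x b j) := by
  have hlength : (Nat.digits b k).length ≤ L := (Nat.digits_length_le_iff hb k).2 hk
  rw [walsh, ← Finset.prod_pow_eq_pow_sum]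
  refine Finset.prod_subset (Finset.range_subset_range.2 hlength) fun j _ hj => ?_
  have hdigit : k / b ^ j = 0 := Nat.div_eq_of_lt ((Nat.lt_base_pow_length_digits hb).trans_le
    (Nat.pow_le_pow_right (NeZero.pos b) (by simpa using hj)))
  rw [hdigit, Nat.zero_mod, zero_mul, pow_zero]

theorem leading_digit_ne_zero (hb : 0 < b) {k l : ℕ} (hl : l ≠ 0) (hk : b ^ l / b ≤ k)
    (hk' : k < b ^ l) : k / b ^ (l - 1) % b ≠ 0 := by
  obtain ⟨n, rfl⟩ := Nat.exists_eq_succ_of_ne_zero hl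
  rw [Nat.succ_eq_add_one, pow_succ] at hk hk'
  rw [Nat.mul_div_cancel _ hb] at hk
  rw [Nat.succ_eq_add_one, Nat.add_sub_cancel, Nat.mod_eq_of_lt (Nat.div_lt_of_lt_mul hk')]
  exact (Nat.div_pos hk (by positivity)).ne'

end DigitCharacters

section ProductMeasures

variable {κ : Type*} {Ω : κ → Type*} [∀ p, MeasurableSpace (Ω p)] {μ : ∀ p, Measure (Ω p)}
  [∀ p, IsProbabilityMeasure (μ p)]

theorem integral_infinitePi_finset_prod {𝕜 : Type*} [RCLike 𝕜] (S : Finset κ) {g : ∀ p, Ω p → 𝕜}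
    (hg : ∀ p, AEStronglyMeasurable (g p) (μ p)) :
    ∫ P, ∏ p ∈ S, g p (P p) ∂Measure.infinitePi μ = ∏ p ∈ S, ∫ ω, g p ω ∂μ p := by
  have hindep : ProbabilityTheory.iIndepFun (fun (p : S) (P : ∀ p, Ω p) => P p)
      (Measure.infinitePi μ) :=
    (ProbabilityTheory.iIndepFun_infinitePi fun _ => measurable_id).precomp
      Subtype.val_injective
  simp only [← Finset.prod_coe_sort S]
  rw [hindep.integral_fun_prod_comp (f := fun p : S => g p)
    (fun p => (measurable_pi_apply (p : κ)).aemeasurable)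
    fun p => by rw [Measure.infinitePi_map_eval]; exact hg p]
  refine Finset.prod_congr rfl fun p _ => ?_
  rw [← integral_map (measurable_pi_apply (p : κ)).aemeasurable
    (by rw [Measure.infinitePi_map_eval]; exact hg p), Measure.infinitePi_map_eval]

theorem ae_frequently_mem_of_tsum_eq_top {node : ℕ → κ} (hnode : Function.Injective node)
    {A : ∀ a, Set (Ω (node a))} (hA : ∀ a, MeasurableSet (A a))
    (hsum : ∑' a, μ (node a) (A a) = ⊤) :
    ∀ᵐ P ∂Measure.infinitePi μ, ∃ᶠ a in Filter.atTop, P (node a) ∈ A a := by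
  have hmeas (a : ℕ) : MeasurableSet ((fun P : ∀ p, Ω p => P (node a)) ⁻¹' A a) :=
    measurable_pi_apply _ (hA a)
  have hindep : ProbabilityTheory.iIndepSet (fun a => (fun P : ∀ p, Ω p => P (node a)) ⁻¹' A a)
      (Measure.infinitePi μ) :=
    (ProbabilityTheory.iIndepSet_iff_meas_biInter hmeas).2 fun s =>
      ((ProbabilityTheory.iIndepFun_infinitePi fun _ => measurable_id).precomp
        hnode).measure_inter_preimage_eq_mul s fun a _ => hA a
  have hlimsup := ProbabilityTheory.measure_limsup_eq_one hmeas hindep <| by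
    simpa only [(measurePreserving_eval_infinitePi μ _).measure_preimage
      (hA _).nullMeasurableSet] using hsum
  rw [← prob_compl_eq_zero_iff (.measurableSet_limsup hmeas), ← mem_ae_iff] at hlimsup
  filter_upwards [hlimsup] with P hP
  exact Filter.mem_limsup_iff_frequently_mem.1 hP

end ProductMeasures

section Scrambling

open scoped BigOperators

variable {b : ℕ}

/-- The uniform distribution on the permutations of the digits. -/
noncomputable def permLaw (b : ℕ) : Measure (Equiv.Perm (Fin b)) :=
  (PMF.uniformOfFintype (Equiv.Perm (Fin b))).toMeasure

instance instIsProbabilityMeasurePermLaw : IsProbabilityMeasure (permLaw b) := by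
  rw [permLaw]
  infer_instance

instance instMeasurableSingletonClassPerm : MeasurableSingletonClass (Equiv.Perm (Fin b)) :=
  ⟨fun _ => trivial⟩

theorem integral_permLaw (f : Equiv.Perm (Fin b) → ℂ) : ∫ π, f π ∂permLaw b = 𝔼 π, f π := by
  rw [permLaw, PMF.integral_eq_sum, Fintype.expect_eq_sum_div_card, Finset.sum_div]
  refine Finset.sum_congr rfl fun π _ => ?_
  rw [PMF.uniformOfFintype_apply, ENNReal.toReal_inv, ENNReal.toReal_natCast, Complex.real_smul,
    Complex.ofReal_inv, Complex.ofReal_natCast, inv_mul_eq_div]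

theorem scrambleLaw_eq_infinitePi (b : ℕ) (ι : Type) :
    scrambleLaw b ι = Measure.infinitePi fun _ : ι × List (Fin b) => permLaw b :=
  rfl

theorem inv_card_perm_le_permLaw [NeZero b] (hb : 1 < b) (v : Fin b) :
    (Fintype.card (Equiv.Perm (Fin b)) : ENNReal)⁻¹ ≤ permLaw b {π | (π v : ℕ) + 1 < b} := by
  rw [← PMF.uniformOfFintype_apply (Equiv.swap v 0),
    ← PMF.toMeasure_apply_singleton _ _ (measurableSet_singleton _)]
  refine measure_mono (Set.singleton_subset_iff.2 ?_)
  simpa using hb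

/-- The action of a family of permutations, indexed by the possible strings of preceding digits, on
a digit sequence: the digitwise form of `scramble`. -/
def scrambleDigits {α : Type*} (σ : List α → Equiv.Perm α) (u : ℕ → α) : ℕ → α :=
  fun a => σ (initialWord u a) (u a)

theorem ae_isProperExpansion_scrambleDigits [NeZero b] (hb : 1 < b) {ι : Type} (i : ι)
    (u : ℕ → Fin b) :
    ∀ᵐ P ∂scrambleLaw b ι, IsProperExpansion (scrambleDigits (fun w => P (i, w)) u) := by
  rw [scrambleLaw_eq_infinitePi]
  refine ae_frequently_mem_of_tsum_eq_top (Ω := fun _ : ι × List (Fin b) => Equiv.Perm (Fin b))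
    (μ := fun _ => permLaw b) (node := fun a => (i, initialWord u a))
    (A := fun a => {π | (π (u a) : ℕ) + 1 < b})
    ((Prod.mk_right_injective i).comp (initialWord_injective u))
    (fun _ => MeasurableSpace.measurableSet_top) (top_unique ?_)
  rw [← ENNReal.tsum_const_eq_top_of_ne_zero (α := ℕ)
    (ENNReal.inv_ne_zero.2 (ENNReal.natCast_ne_top (Fintype.card (Equiv.Perm (Fin b)))))]
  exact ENNReal.tsum_le_tsum fun a => inv_card_perm_le_permLaw hb (u a)

theorem ae_digits_scramble [NeZero b] (hb : 1 < b) {ι : Type} [Countable ι] (x : ι → ℝ) :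
    ∀ᵐ P ∂scrambleLaw b ι, ∀ i, Real.digits (scramble P x i) b =
      scrambleDigits (fun w => P (i, w)) (Real.digits (x i) b) := by
  refine ae_all_iff.2 fun i => ?_
  filter_upwards [ae_isProperExpansion_scrambleDigits hb i (Real.digits (x i) b)] with P hP
  exact digits_ofDigits hP

end Scrambling

section NodeFactors

open scoped BigOperators ComplexConjugate

variable {b : ℕ} {χ : ℕ → Fin b → ℂ} {l : ℕ} {u v : ℕ → Fin b}

/-- The contribution of the permutation `π` at the string `w` to the product of
`∏ j ∈ range l, χ j` at the scrambling of `u` and its conjugate at the scrambling of `v`. -/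
noncomputable def nodeFactor (χ : ℕ → Fin b → ℂ) (l : ℕ) (u v : ℕ → Fin b) (w : List (Fin b))
    (π : Equiv.Perm (Fin b)) : ℂ :=
  (if w ∈ initialWords u l then χ w.length (π (u w.length)) else 1) *
    if w ∈ initialWords v l then conj (χ w.length (π (v w.length))) else 1

theorem prod_nodeFactor {T : Finset (List (Fin b))} (hu : initialWords u l ⊆ T)
    (hv : initialWords v l ⊆ T) (σ : List (Fin b) → Equiv.Perm (Fin b)) :
    ∏ w ∈ T, nodeFactor χ l u v w (σ w) =
      (∏ j ∈ Finset.range l, χ j (scrambleDigits σ u j)) *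
        conj (∏ j ∈ Finset.range l, χ j (scrambleDigits σ v j)) := by
  simp only [nodeFactor]
  rw [Finset.prod_mul_distrib,
    prod_ite_mem_initialWords hu fun w => χ w.length (σ w (u w.length)),
    prod_ite_mem_initialWords hv fun w => conj (χ w.length (σ w (v w.length))), map_prod]
  simp only [length_initialWord, scrambleDigits]

theorem nodeFactor_of_notMem {w : List (Fin b)} (hu : w ∉ initialWords u l)
    (hv : w ∉ initialWords v l) (π : Equiv.Perm (Fin b)) : nodeFactor χ l u v w π = 1 := by
  rw [nodeFactor, if_neg hu, if_neg hv, one_mul]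

theorem nodeFactor_of_length_lt (hχ : ∀ j a, ‖χ j a‖ = 1) {n : ℕ}
    (hagree : initialWord u n = initialWord v n) {w : List (Fin b)} (hw : w.length < n)
    (π : Equiv.Perm (Fin b)) : nodeFactor χ l u v w π = 1 := by
  have hmem : w ∈ initialWords u l ↔ w ∈ initialWords v l := by
    rw [mem_initialWords, mem_initialWords, initialWord_eq_of_le hw.le hagree]
  by_cases hwu : w ∈ initialWords u l
  · rw [nodeFactor, if_pos hwu, if_pos (hmem.1 hwu), initialWord_eq_iff.1 hagree _ hw,
      Complex.mul_conj', hχ, Complex.ofReal_one, one_pow]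
  · exact nodeFactor_of_notMem hwu (mt hmem.2 hwu) π

theorem prod_integral_nodeFactor_of_agree (hχ : ∀ j a, ‖χ j a‖ = 1)
    (hagree : initialWord u l = initialWord v l) (T : Finset (List (Fin b))) :
    ∏ w ∈ T, ∫ π, nodeFactor χ l u v w π ∂permLaw b = 1 := by
  refine Finset.prod_eq_one fun w _ => ?_
  have hone : nodeFactor χ l u v w = 1 := by
    funext π
    rcases lt_or_ge w.length l with hw | hw
    · exact nodeFactor_of_length_lt hχ hagree hw π
    · exact nodeFactor_of_notMem (fun h => hw.not_gt (mem_initialWords.1 h).1)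
        (fun h => hw.not_gt (mem_initialWords.1 h).1) π
  simp [hone]

theorem prod_integral_nodeFactor_of_last_ne (hχ : ∀ j a, ‖χ j a‖ = 1)
    (hsum : ∑ a, χ l a = 0) (hagree : initialWord u l = initialWord v l) (hne : u l ≠ v l)
    {T : Finset (List (Fin b))} (hu : initialWords u (l + 1) ⊆ T) :
    ∏ w ∈ T, ∫ π, nodeFactor χ (l + 1) u v w π ∂permLaw b = -1 / ((b : ℂ) - 1) := by
  have hwu : initialWord u l ∈ initialWords u (l + 1) :=
    initialWord_mem_initialWords (Nat.lt_succ_self l)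
  have hwv : initialWord u l ∈ initialWords v (l + 1) :=
    hagree ▸ initialWord_mem_initialWords (Nat.lt_succ_self l)
  have hb : (b : ℂ) - 1 ≠ 0 := by
    have : b ≠ 1 := by lia
    exact sub_ne_zero.2 (by exact_mod_cast this)
  have hsum_conj : ∑ a, conj (χ l a) = 0 := by rw [← map_sum, hsum, map_zero]
  have : Nonempty (Fin b) := ⟨u l⟩
  rw [Finset.prod_eq_single_of_mem _ (hu hwu) fun w _ hw => ?_]
  · simp only [nodeFactor, if_pos hwu, if_pos hwv, length_initialWord]
    rw [integral_permLaw, eq_div_iff hb, mul_comm]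
    simpa only [Complex.mul_conj', hχ, Fintype.card_fin, Complex.ofReal_one, one_pow,
      Fintype.expect_const] using expect_perm_apply_mul_apply hsum_conj (χ l) hne
  · have hone : nodeFactor χ (l + 1) u v w = 1 := by
      funext π
      rcases lt_or_ge w.length l with hlt | hge
      · exact nodeFactor_of_length_lt hχ hagree hlt π
      · have hnot : ∀ t : ℕ → Fin b, initialWord t l = initialWord u l →
            w ∉ initialWords t (l + 1) := fun t ht h => by
          obtain ⟨hlength, heq⟩ := mem_initialWords.1 h
          rw [le_antisymm (Nat.lt_succ_iff.1 hlength) hge, ht] at heq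
          exact hw heq.symm
        exact nodeFactor_of_notMem (hnot u rfl) (hnot v hagree.symm) π
    simp [hone]

theorem prod_integral_nodeFactor_of_not_agree (hsum : ∑ a, χ l a = 0)
    (hne : initialWord u l ≠ initialWord v l) {T : Finset (List (Fin b))}
    (hu : initialWords u (l + 1) ⊆ T) :
    ∏ w ∈ T, ∫ π, nodeFactor χ (l + 1) u v w π ∂permLaw b = 0 := by
  have hwu : initialWord u l ∈ initialWords u (l + 1) :=
    initialWord_mem_initialWords (Nat.lt_succ_self l)
  have hwv : initialWord u l ∉ initialWords v (l + 1) := fun h => by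
    have heq := (mem_initialWords.1 h).2
    rw [length_initialWord] at heq
    exact hne heq.symm
  refine Finset.prod_eq_zero (hu hwu) ?_
  simp only [nodeFactor, if_pos hwu, if_neg hwv, length_initialWord, mul_one]
  rw [integral_permLaw, expect_perm_apply (χ l), Fintype.expect_eq_sum_div_card, hsum, zero_div]

theorem prod_integral_nodeFactor (hχ : ∀ j a, ‖χ j a‖ = 1)
    (hsum : l ≠ 0 → ∑ a, χ (l - 1) a = 0) {T : Finset (List (Fin b))}
    (hu : initialWords u l ⊆ T) :
    ∏ w ∈ T, ∫ π, nodeFactor χ l u v w π ∂permLaw b = (gainKernel l u v : ℂ) := by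
  rw [gainKernel]
  split_ifs with hagree hagree'
  · rw [prod_integral_nodeFactor_of_agree hχ hagree T, Complex.ofReal_one]
  all_goals
    obtain ⟨n, rfl⟩ : ∃ n, l = n + 1 := Nat.exists_eq_succ_of_ne_zero fun h =>
      hagree (by simp [h, initialWord])
    replace hsum := hsum n.succ_ne_zero
    rw [Nat.add_sub_cancel] at hagree' hsum
  · have hlast : u n ≠ v n := fun h => hagree <| initialWord_eq_iff.2 <|
      Nat.forall_lt_succ_right.2 ⟨initialWord_eq_iff.1 hagree', h⟩
    rw [prod_integral_nodeFactor_of_last_ne hχ hsum hagree' hlast hu]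
    push_cast
    rfl
  · rw [prod_integral_nodeFactor_of_not_agree hsum hagree' hu, Complex.ofReal_zero]

end NodeFactors

section WalshExpectation

open scoped ComplexConjugate

variable {b : ℕ} {ι : Type} [Fintype ι]

theorem integral_prod_mul_conj_scrambleDigits {χ : ι → ℕ → Fin b → ℂ} {l : ι → ℕ}
    (hχ : ∀ i j a, ‖χ i j a‖ = 1) (hsum : ∀ i, l i ≠ 0 → ∑ a, χ i (l i - 1) a = 0)
    (u v : ι → ℕ → Fin b) :
    ∫ P : PermFamily b ι, ∏ i,
        (∏ j ∈ Finset.range (l i), χ i j (scrambleDigits (fun w => P (i, w)) (u i) j)) *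
          conj (∏ j ∈ Finset.range (l i), χ i j (scrambleDigits (fun w => P (i, w)) (v i) j))
      ∂scrambleLaw b ι = ((∏ i, gainKernel (l i) (u i) (v i) : ℝ) : ℂ) := by
  obtain ⟨T, hT⟩ : ∃ T, ∀ i, initialWords (u i) (l i) ∪ initialWords (v i) (l i) ⊆ T :=
    ⟨_, fun i => Finset.subset_biUnion_of_mem
      (fun i => initialWords (u i) (l i) ∪ initialWords (v i) (l i)) (Finset.mem_univ i)⟩
  have hu (i : ι) : initialWords (u i) (l i) ⊆ T := Finset.subset_union_left.trans (hT i)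
  have hv (i : ι) : initialWords (v i) (l i) ⊆ T := Finset.subset_union_right.trans (hT i)
  let g (p : ι × List (Fin b)) : Equiv.Perm (Fin b) → ℂ :=
    nodeFactor (χ p.1) (l p.1) (u p.1) (v p.1) p.2
  calc
    _ = ∫ P, ∏ p ∈ Finset.univ ×ˢ T, g p (P p)
          ∂Measure.infinitePi fun _ : ι × List (Fin b) => permLaw b := by
        rw [scrambleLaw_eq_infinitePi]
        refine integral_congr_ae (.of_forall fun P => ?_)
        simp only [Finset.prod_product]
        exact Finset.prod_congr rfl fun i _ =>
          (prod_nodeFactor (hu i) (hv i) fun w => P (i, w)).symm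
    _ = ∏ p ∈ Finset.univ ×ˢ T, ∫ π, g p π ∂permLaw b :=
        integral_infinitePi_finset_prod _ fun _ => measurable_from_top.aestronglyMeasurable
    _ = ∏ i, (gainKernel (l i) (u i) (v i) : ℂ) := by
        rw [Finset.prod_product]
        exact Finset.prod_congr rfl fun i _ =>
          prod_integral_nodeFactor (u := u i) (v := v i) (hχ i) (hsum i) (hu i)
    _ = _ := (Complex.ofReal_prod _ _).symm

theorem integral_walshMulti_scramble [NeZero b] (hb : 1 < b) {l k : ι → ℕ}
    (hk : k ∈ walshBlock b l) (x y : ι → ℝ) :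
    ∫ P, walshMulti b k (scramble P x) * conj (walshMulti b k (scramble P y)) ∂scrambleLaw b ι =
      ((∏ i, gainKernel (l i) (Real.digits (x i) b) (Real.digits (y i) b) : ℝ) : ℂ) := by
  rw [← integral_prod_mul_conj_scrambleDigits (χ := fun i j => digitChar b (k i / b ^ j % b))
    (fun _ _ => norm_digitChar) fun i hi => sum_digitChar
      (leading_digit_ne_zero (NeZero.pos b) hi (hk i).1 (hk i).2) (Nat.mod_lt _ (NeZero.pos b))]
  refine integral_congr_ae ?_
  filter_upwards [ae_digits_scramble hb x, ae_digits_scramble hb y] with P hx hy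
  simp only [walshMulti, walsh_eq_prod hb (hk _).2, hx, hy, map_prod, Finset.prod_mul_distrib]

end WalshExpectation

section Gain

open scoped BigOperators

variable {b : ℕ} {ν ι : Type*} [Fintype ν] [Fintype ι] {u : ν → ι → ℕ → Fin b}

/-- Pairwise form of the net property for a family of digit sequences: for each `n`, the proportion
of the `n'` that share with `n` the first `e i` digits of every coordinate `i` is the volume
`∏ i, (b ^ e i)⁻¹` of the corresponding elementary interval, as long as `∑ i, e i ≤ M`. -/
def IsPairEquidistributed (M : ℕ) (u : ν → ι → ℕ → Fin b) : Prop :=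
  ∀ e : ι → ℕ, ∑ i, e i ≤ M → ∀ n,
    𝔼 n', ∏ i, agreement (e i) (u n i) (u n' i) = ∏ i, ((b : ℝ) ^ e i)⁻¹

theorem IsPairEquidistributed.expect_prod_sum {M : ℕ} (hu : IsPairEquidistributed M u)
    {κ : Type*} [Fintype κ] {l : ι → ℕ} (hl : ∑ i, l i ≤ M) {e : ι → κ → ℕ}
    (he : ∀ i c, e i c ≤ l i) (f : ι → κ → ℝ) (n : ν) :
    𝔼 n', ∏ i, ∑ c, f i c * agreement (e i c) (u n i) (u n' i) =
      ∏ i, ∑ c, f i c * ((b : ℝ) ^ e i c)⁻¹ := by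
  classical
  simp only [Finset.prod_univ_sum, Finset.prod_mul_distrib]
  rw [Finset.expect_sum_comm]
  refine Finset.sum_congr rfl fun c _ => ?_
  rw [← Finset.mul_expect, hu (fun i => e i (c i))
    ((Finset.sum_le_sum fun i _ => he i (c i)).trans hl) n]

/-- The gain coefficient in terms of the digits of the points. -/
noncomputable def gain (l : ι → ℕ) (u : ν → ι → ℕ → Fin b) : ℝ :=
  𝔼 n, 𝔼 n', ∏ i, gainKernel (l i) (u n i) (u n' i)

theorem IsPairEquidistributed.gain_eq_zero (hb : 1 < b) {M : ℕ} (hu : IsPairEquidistributed M u)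
    {l : ι → ℕ} (hl : l ≠ 0) (hlM : ∑ i, l i ≤ M) : gain l u = 0 := by
  obtain ⟨i, hi⟩ := Function.ne_iff.1 hl
  refine Finset.expect_eq_zero fun n _ => ?_
  simp only [gainKernel_eq_sum_agreement hb]
  rw [hu.expect_prod_sum hlM (e := fun i => ![l i, l i - 1])
    fun i c => by fin_cases c <;> simp]
  -- The interval of `l i` digits is `b` times smaller than that of `l i - 1` digits.
  have hcancel : (b : ℝ) / (b - 1) * ((b : ℝ) ^ l i)⁻¹ +
      -1 / (b - 1) * ((b : ℝ) ^ (l i - 1))⁻¹ = 0 := by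
    obtain ⟨a, ha⟩ := Nat.exists_eq_succ_of_ne_zero hi
    have hb0 : (b : ℝ) ≠ 0 := by positivity
    rw [ha, Nat.succ_eq_add_one, Nat.add_sub_cancel, pow_succ]
    field_simp
    ring
  refine Finset.prod_eq_zero (Finset.mem_univ i) ?_
  rw [Fin.sum_univ_two]
  exact hcancel

theorem IsPairEquidistributed.abs_gain_le [Nonempty ν] (hb : 1 < b) {M : ℕ}
    (hu : IsPairEquidistributed M u) {e l : ι → ℕ} (hel : ∀ i, e i ≤ l i - 1)
    (heM : ∑ i, e i ≤ M) : |gain l u| ≤ ((b : ℝ) ^ ∑ i, e i)⁻¹ := by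
  have hterm (n n' : ν) : |∏ i, gainKernel (l i) (u n i) (u n' i)| ≤
      ∏ i, agreement (e i) (u n i) (u n' i) := by
    rw [Finset.abs_prod]
    exact Finset.prod_le_prod (fun _ _ => abs_nonneg _) fun i _ =>
      abs_gainKernel_le_agreement hb (hel i) _ _
  calc |gain l u| ≤ 𝔼 n, 𝔼 n', |∏ i, gainKernel (l i) (u n i) (u n' i)| :=
        (Finset.abs_expect_le _ _).trans
          (Finset.expect_le_expect fun _ _ => Finset.abs_expect_le _ _)
    _ ≤ 𝔼 n, 𝔼 n', ∏ i, agreement (e i) (u n i) (u n' i) :=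
        Finset.expect_le_expect fun n _ => Finset.expect_le_expect fun n' _ => hterm n n'
    _ = ((b : ℝ) ^ ∑ i, e i)⁻¹ := by
        simp only [hu e heM, Fintype.expect_const, Finset.prod_inv_distrib,
          Finset.prod_pow_eq_pow_sum]

theorem IsPairEquidistributed.abs_gain_le_inv_pow [Nonempty ν] (hb : 1 < b) {M : ℕ}
    (hu : IsPairEquidistributed M u) {l : ι → ℕ} (hM : M ≤ ∑ i, (l i - 1)) :
    |gain l u| ≤ ((b : ℝ) ^ M)⁻¹ := by
  obtain ⟨e, hel, he⟩ := Finsupp.exists_le_degree_eq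
    (Finsupp.equivFunOnFinite.symm fun i => l i - 1) M (by simpa [Finsupp.degree_eq_sum] using hM)
  rw [Finsupp.degree_eq_sum] at he
  exact he ▸ hu.abs_gain_le hb hel he.le

end Gain

section Nets

open scoped BigOperators

variable {b : ℕ} [NeZero b]

theorem mem_Ico_floor_iff_initialWord_eq {x y : ℝ} (hx : x ∈ Set.Ico (0 : ℝ) 1)
    (hy : y ∈ Set.Ico (0 : ℝ) 1) (n : ℕ) :
    y ∈ Set.Ico ((⌊(b : ℝ) ^ n * x⌋₊ : ℝ) / (b : ℝ) ^ n)
        (((⌊(b : ℝ) ^ n * x⌋₊ : ℝ) + 1) / (b : ℝ) ^ n) ↔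
      initialWord (Real.digits x b) n = initialWord (Real.digits y b) n := by
  have hpow : (0 : ℝ) < (b : ℝ) ^ n := by
    have := NeZero.pos b
    positivity
  rw [initialWord_eq_iff, forall_digits_eq_iff_floor_eq hx hy, eq_comm,
    Nat.floor_eq_iff (mul_nonneg hpow.le hy.1), Set.mem_Ico, div_le_iff₀' hpow, lt_div_iff₀' hpow]

theorem IsNet.isPairEquidistributed {t m : ℕ} {ι : Type} [Fintype ι] {z : Fin (b ^ m) → ι → ℝ}
    (hz : IsNet b t m z) : IsPairEquidistributed (m - t) fun n i => Real.digits (z n i) b := by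
  classical
  intro e he n
  have hb : (0 : ℝ) < b := by exact_mod_cast NeZero.pos b
  rcases le_or_gt t m with htm | htm
  · have hfloor (i : ι) : ⌊(b : ℝ) ^ e i * z n i⌋₊ < b ^ e i := by
      rw [Nat.floor_lt' (pow_ne_zero _ (NeZero.ne b)), Nat.cast_pow]
      exact mul_lt_of_lt_one_right (by positivity) (hz.1 n i).2
    have hcard := hz.2 e (by lia) _ hfloor
    simp only [mem_Ico_floor_iff_initialWord_eq (hz.1 n _) (hz.1 _ _)] at hcard
    rw [Nat.card_eq_fintype_card, Fintype.card_subtype] at hcard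
    simp only [agreement, Finset.prod_ite_zero, Finset.prod_const_one, Finset.mem_univ,
      true_imp_iff]
    rw [Fintype.expect_eq_sum_div_card, Finset.sum_boole, hcard, Finset.prod_inv_distrib,
      Finset.prod_pow_eq_pow_sum, Nat.cast_pow, pow_sub₀ _ hb.ne' (by lia), Fintype.card_fin,
      Nat.cast_pow, mul_div_cancel_left₀ _ (pow_ne_zero m hb.ne')]
  · obtain rfl : e = 0 := by
      funext i
      have := Finset.single_le_sum (fun i _ => Nat.zero_le (e i)) (Finset.mem_univ i)
      simp only [Pi.zero_apply]
      lia
    simp [agreement, initialWord]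

theorem gainCoeff_interlace (hb : 1 < b) {d s m : ℕ} {z : Fin (b ^ m) → Fin s × Fin d → ℝ}
    (hz : ∀ n p, z n p ∈ Set.Ico (0 : ℝ) 1) {x : Fin (b ^ m) → Fin s → ℝ}
    (hx : ∀ n i, x n i = interlace b d fun r => z n (i, r)) {l k : Fin s × Fin d → ℕ}
    (hk : k ∈ walshBlock b l) :
    gainCoeff b d x k = (gain l (fun n p => Real.digits (z n p) b) : ℂ) := by
  have hinv (n : Fin (b ^ m)) (i : Fin s) : interlaceInv b d (x n i) = fun r => z n (i, r) := by
    rw [hx, interlaceInv_interlace hb fun r => hz n (i, r)]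
  have hblock (i : Fin s) : (fun r => k (i, r)) ∈ walshBlock b fun r => l (i, r) :=
    fun r => hk (i, r)
  simp only [gainCoeff, gain, hinv, integral_walshMulti_scramble hb (hblock _),
    ← Complex.ofReal_prod, ← Fintype.prod_prod_type', Fintype.expect_eq_sum_div_card,
    Fintype.card_fin, ← Finset.sum_div]
  push_cast
  rw [two_mul, pow_add, div_div, div_mul_eq_mul_div, one_mul]

end Nets

section Weights

theorem sum_pred_add_card_support {ι : Type*} [Fintype ι] (l : ι → ℕ) {q : Finset ι}
    (hq : ∀ i, i ∈ q ↔ l i ≠ 0) : ∑ i, (l i - 1) + q.card = ∑ i, l i := by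
  classical
  obtain rfl : q = Finset.univ.filter fun i => l i ≠ 0 := by
    ext i
    simp [hq]
  rw [Finset.card_filter, ← Finset.sum_add_distrib]
  refine Finset.sum_congr rfl fun i _ => ?_
  split_ifs <;> lia

end Weights

end OwenScrambling

theorem mainTheorem3_general {b d s t m : ℕ} [NeZero b] (hb : 1 < b)
    {z : Fin (b ^ m) → Fin s × Fin d → ℝ} (hz : OwenScrambling.IsNet b t m z)
    {x : Fin (b ^ m) → Fin s → ℝ}
    (hx : ∀ n i, x n i = OwenScrambling.interlace b d (fun r => z n (i, r)))
    {l : Fin s × Fin d → ℕ} (hl : l ≠ 0)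
    {q : Finset (Fin s × Fin d)} (hq : ∀ p, p ∈ q ↔ l p ≠ 0)
    {k : Fin s × Fin d → ℕ} (hk : k ∈ OwenScrambling.walshBlock b l) :
    ∃ γ : ℝ, OwenScrambling.gainCoeff b d x k = (γ : ℂ) ∧
      (((∑ p, l p : ℕ) : ℤ) ≤ (m : ℤ) - t → γ = 0) ∧
      ((m : ℤ) - t < ((∑ p, l p : ℕ) : ℤ) →
        ((∑ p, l p : ℕ) : ℤ) ≤ (m : ℤ) - t + q.card →
          γ ≤ (b : ℝ) ^ ((q.card : ℤ) - ((∑ p, l p : ℕ) : ℤ))) ∧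
      ((m : ℤ) - t + q.card < ((∑ p, l p : ℕ) : ℤ) → γ ≤ (b : ℝ) ^ (-(m : ℤ) + t)) := by
  have hu := hz.isPairEquidistributed
  have hsum := OwenScrambling.sum_pred_add_card_support l hq
  refine ⟨_, OwenScrambling.gainCoeff_interlace hb hz.1 hx hk,
    fun hle => hu.gain_eq_zero hb hl (by lia), fun _ hle => ?_, fun hlt => ?_⟩
  · calc _ ≤ ((b : ℝ) ^ ∑ p, (l p - 1))⁻¹ :=
          (le_abs_self _).trans (hu.abs_gain_le hb (fun _ => le_rfl) (by lia))
      _ = (b : ℝ) ^ ((q.card : ℤ) - ((∑ p, l p : ℕ) : ℤ)) := by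
          rw [← zpow_natCast, ← zpow_neg]
          congr 1
          lia
  · calc _ ≤ ((b : ℝ) ^ (m - t))⁻¹ :=
          (le_abs_self _).trans (hu.abs_gain_le_inv_pow hb (by lia))
      _ ≤ (b : ℝ) ^ (-(m : ℤ) + t) := by
          rw [← zpow_natCast, ← zpow_neg]
          exact zpow_le_zpow_right₀ (by exact_mod_cast hb.le) (by lia)

theorem mainTheorem3 (b d s t m : ℕ) [Fact b.Prime]
    (z : Fin (b ^ m) → Fin s × Fin d → ℝ)
    (hz : OwenScrambling.IsDigitalNet b t m z)
    (x : Fin (b ^ m) → Fin s → ℝ)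
    (hx : ∀ n i, x n i = OwenScrambling.interlace b d (fun r => z n (i, r)))
    (l : Fin s × Fin d → ℕ) (hl : l ≠ 0)
    (q : Finset (Fin s × Fin d)) (hq : ∀ p, p ∈ q ↔ l p ≠ 0)
    (k : Fin s × Fin d → ℕ) (hk : k ∈ OwenScrambling.walshBlock b l) :
    ∃ γ : ℝ, OwenScrambling.gainCoeff b d x k = (γ : ℂ) ∧
      (((∑ p, l p : ℕ) : ℤ) ≤ (m : ℤ) - t → γ = 0) ∧
      ((m : ℤ) - t < ((∑ p, l p : ℕ) : ℤ) →
        ((∑ p, l p : ℕ) : ℤ) ≤ (m : ℤ) - t + q.card →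
          γ ≤ (b : ℝ) ^ ((q.card : ℤ) - ((∑ p, l p : ℕ) : ℤ))) ∧
      ((m : ℤ) - t + q.card < ((∑ p, l p : ℕ) : ℤ) → γ ≤ (b : ℝ) ^ (-(m : ℤ) + t)) :=
  mainTheorem3_general (Fact.out : b.Prime).one_lt hz.2 hx hl hq hk
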